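/- All graphs are finite and simple. Let $\omega(H)$ denote the number of connected components of $H$. For a real number $t>0$, a graph $G$ is \emph{$t$-tough} if $\omega(G\setminus S)\le\max\{1,|S|/t\}$ for every $S\subseteq V(G)$. The \emph{toughness} $t(G)$ is the maximum positive real $t$ for which $G$ is $t$-tough (if it exists). The graph $G$ is \emph{minimally $t$-tough} if $t(G)=t$ and, for every edge $e$ of $G$, the graph $G-e$ is not $t$-tough. The Generalized Kriesell Conjecture states that for every real $t>0$, every minimally $t$-tough graph has a vertex of degree $\lceil 2t\rceil$. For an even integer $m\ge 4$, let $G_m$ be the graph with the $6m$ vertices $v_{i,j}$, $1\le i\le m$, $1\le j\le 6$, and the following edges (the index $i+1$ is taken modulo $m$, so that $m+1$ means $1$): * for each $i$, the edges $v_{i,1}v_{i,2},\ v_{i,2}v_{i,3},\ v_{i,3}v_{i,4},\ v_{i,4}v_{i,5},\ v_{i,5}v_{i,1}$ and $v_{i,6}v_{i,1},\ v_{i,6}v_{i,2},\ v_{i,6}v_{i,3},\ v_{i,6}v_{i,4}$; * for each even $i$, the edges $v_{i,1}v_{i+1,1},\ v_{i,2}v_{i+1,5},\ v_{i,5}v_{i+1,2}$;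 * for each odd $i$, the edges $v_{i,4}v_{i+1,4},\ v_{i,3}v_{i+1,5},\ v_{i,5}v_{i+1,3}$. **Theorem.** For every even $m\ge 4$, the graph $G_m$ has $6m$ vertices, is planar and $4$-regular, has toughness exactly $3/2$, is minimally $3/2$-tough, and is a counterexample to the Generalized Kriesell Conjecture. Consequently, there are infinitely many integers $n$ for which there is a planar, $4$-regular, minimally $3/2$-tough graph on $n$ vertices that is a counterexample to the Generalized Kriesell Conjecture; in particular, there are infinitely many planar minimally $3/2$-tough $4$-regular graphs. -/

import Mathlib

namespace ToughRing

variable {V : Type*}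

/-- `A` is an arc in the plane with end points `a` and `b`: the image of `[0, 1]` under an
injective continuous map that sends `0` to `a` and `1` to `b`. -/
def IsArc (A : Set (ℝ × ℝ)) (a b : ℝ × ℝ) : Prop :=
  ∃ f : unitInterval → ℝ × ℝ,
    Continuous f ∧ Function.Injective f ∧ f 0 = a ∧ f 1 = b ∧ Set.range f = A

/-- `G` is planar: its vertices can be drawn as distinct points of the plane and its edges as arcs
joining their end vertices, so that an arc contains no vertex other than the two ends of its edge,
and two different arcs meet only in vertices. -/
def IsPlanar (G : SimpleGraph V) : Prop :=
  ∃ (p : V → ℝ × ℝ) (arc : Sym2 V → Set (ℝ × ℝ)),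
    Function.Injective p ∧
    (∀ u v, G.Adj u v → IsArc (arc s(u, v)) (p u) (p v)) ∧
    (∀ e ∈ G.edgeSet, ∀ w, p w ∈ arc e → w ∈ e) ∧
    (∀ e ∈ G.edgeSet, ∀ e' ∈ G.edgeSet, e ≠ e' → arc e ∩ arc e' ⊆ Set.range p)

/-- The number of connected components of `G` with the vertices of `S` removed. -/
noncomputable def numComponents (G : SimpleGraph V) (S : Finset V) : ℕ :=
  Nat.card (G.induce {v | v ∉ S}).ConnectedComponent

/-- `G` is `t`-tough (used for positive `t`). -/
def IsTough (G : SimpleGraph V) (t : ℝ) : Prop :=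
  ∀ S : Finset V, (numComponents G S : ℝ) ≤ max 1 (1 / t * S.card)

/-- The toughness of `G` is `t`: `t` is the maximum positive real for which `G` is `t`-tough. -/
def HasToughness (G : SimpleGraph V) (t : ℝ) : Prop :=
  IsGreatest {s : ℝ | 0 < s ∧ IsTough G s} t

/-- `G` is minimally `t`-tough: its toughness is `t`, and no graph `G - e` is `t`-tough. -/
def IsMinimallyTough (G : SimpleGraph V) (t : ℝ) : Prop :=
  HasToughness G t ∧ ∀ e ∈ G.edgeSet, ¬ IsTough (G.deleteEdges {e}) t

open scoped Classical in
/-- Every vertex of the finite graph `G` has degree `r`. -/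
def IsRegular [Fintype V] (G : SimpleGraph V) (r : ℕ) : Prop :=
  G.IsRegularOfDegree r

open scoped Classical in
/-- `G` is a counterexample to the Generalized Kriesell Conjecture ("every minimally `t`-tough
graph, `t > 0`, has a vertex of degree `⌈2t⌉`"). -/
def IsKriesellCounterexample [Fintype V] (G : SimpleGraph V) : Prop :=
  ∃ t : ℝ, 0 < t ∧ IsMinimallyTough G t ∧ ∀ v, (G.degree v : ℤ) ≠ ⌈2 * t⌉

/-- The edges inside one gadget. The vertices of a gadget are labelled `1, …, 6` modulo `6`, so
that `0` is the label `6`: a 5-cycle `1 2 3 4 5`, and `6` joined to `1, 2, 3, 4`. -/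
def gadgetEdges : Finset (Fin 6 × Fin 6) :=
  {(1, 2), (2, 3), (3, 4), (4, 5), (5, 1), (0, 1), (0, 2), (0, 3), (0, 4)}

/-- The three edges from a gadget of even index to the next one. -/
def evenLinks : Finset (Fin 6 × Fin 6) := {(1, 1), (2, 5), (5, 2)}

/-- The three edges from a gadget of odd index to the next one. -/
def oddLinks : Finset (Fin 6 × Fin 6) := {(4, 4), (3, 5), (5, 3)}

/-- The ring of `m` gadgets (`m` even). The vertex `v_{i,j}` is `(i mod m, j mod 6)`; as `m` is
even, the parity of an index `i ∈ {1, …, m}` is that of its residue modulo `m`. -/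
def ringGraph (m : ℕ) : SimpleGraph (Fin m × Fin 6) :=
  SimpleGraph.fromRel fun x y =>
    (x.1 = y.1 ∧ (x.2, y.2) ∈ gadgetEdges) ∨
    ((x.1.val + 1) % m = y.1.val ∧
      ((Even x.1.val ∧ (x.2, y.2) ∈ evenLinks) ∨ (Odd x.1.val ∧ (x.2, y.2) ∈ oddLinks)))

end ToughRing

namespace ToughRing

/-! Reflecting the gadgets of odd index turns the ring into one with the same links everywhere
(`ringIso`), so the work is done on `uniformRing`. Toughness is a transfer-matrix argument. After
the removal of `S`, each gadget is in one of 64 states. A component either ends at some gadget,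
meeting it without a live link onwards from there, or goes on at every gadget and winds round the
ring. `exists_states` bounds the components by `k`, the number that wind, plus the pieces that end;
`k ≤ 2` because vertex 1 is adjacent to the other two link sources. For each `k`, inequalities
between consecutive states, checked by evaluation and summed round the ring, give
`numComponents_le`. The bound is attained: alternating `stateA` and `stateB` removes `3m` vertices
and leaves `2m` components. For minimality, each edge type has a modification of this alternation in
a few gadgets which, once the edge is deleted, leaves too many components
(`exists_isWitness_inside`, `exists_isWitness_link`). These sets are certified by labellings
constant along surviving edges. For planarity, a periodic straight-line drawing in a strip, verified
with integer orientations, is wrapped round an annulus by the complex exponential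
(`isPlanar_uniformRing`). As the graph is 4-regular and `⌈2 · 3/2⌉ = 3`, the conjecture fails. -/

/-! ### Gadget states and their finite inequalities. -/

/-- Adjacency inside a gadget. -/
def gadgetAdj (x y : Fin 6) : Bool := decide ((x, y) ∈ gadgetEdges ∨ (y, x) ∈ gadgetEdges)

/-- The links from a gadget of the uniform ring to the next one. -/
def links : Finset (Fin 6 × Fin 6) := {(1, 4), (2, 5), (5, 3)}

/-- Insert a vertex into a partition of a vertex list into pieces, merging the pieces it touches. -/
def insertVertex (v : Fin 6) (ps : List (List (Fin 6))) : List (List (Fin 6)) :=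
  (v :: (ps.filter fun p => p.any (gadgetAdj v)).flatten) ::
    ps.filter fun p => !p.any (gadgetAdj v)

/-- The connected pieces of the subgraph of a gadget induced by a list of vertices. -/
def pieces (l : List (Fin 6)) : List (List (Fin 6)) := l.foldr insertVertex []

/-- The vertices of a gadget whose bit in `a` is set. -/
def liveList (a : ℕ) : List (Fin 6) := [0, 1, 2, 3, 4, 5].filter fun x => a.testBit x

/-- The vertex `x` has a link into a next gadget whose remaining vertices are given by `b`. -/
def hasLink (b : ℕ) (x : Fin 6) : Bool :=
  (x == 1 && b.testBit 4) || (x == 2 && b.testBit 5) || (x == 5 && b.testBit 3)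

/-- The number of pieces with no link into the next gadget. -/
def numEnding (a b : ℕ) : ℕ := (pieces (liveList a)).countP fun p => !p.any (hasLink b)

/-- The number of pieces with a link into the next gadget. -/
def numPassing (a b : ℕ) : ℕ := (pieces (liveList a)).countP fun p => p.any (hasLink b)

/-- The number of removed vertices of a gadget with remaining vertices `a`. -/
def numRemoved (a : ℕ) : ℕ := 6 - (liveList a).length

/-- A potential on gadget states, used to bound the components that do not wind round the ring. -/
def potential (a : ℕ) : ℕ := [3, 2, 2, 0, 1, 0, 0, 0].getD (a / 8) 0

/-- A piece of `a` may end because vertices of `b` were removed; the potential moves part of that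
cost back to `a`. It reads only bits 3, 4, 5, the targets of the links, and cancels when summed
round the ring. -/
theorem numEnding_le_potential : ∀ a < 64, ∀ b < 64,
    3 * numEnding a b + potential a ≤ 2 * numRemoved a + potential b := by
  decide +kernel


/-- Links start at 1, 2 and 5, and 1 is adjacent to both 2 and 5, so these never lie in three
different pieces. -/
theorem numPassing_le_two : ∀ a < 64, ∀ b < 64, numPassing a b ≤ 2 := by
  decide +kernel

/-- Two passing pieces must separate 2 from 5, which costs vertex 1 and either 4 or both 0 and 3. -/
theorem numEnding_of_two_le_numPassing : ∀ a < 64, ∀ b < 64, 2 ≤ numPassing a b →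
    3 * numEnding a b + 4 ≤ 2 * numRemoved a := by
  decide +kernel

theorem numEnding_of_numPassing_pos : ∀ a < 64, ∀ b < 64, 1 ≤ numPassing a b →
    3 * numEnding a b ≤ 2 * numRemoved a ∧
    (a = 45 ∨ a = 63 ∨ 3 * numEnding a b + 2 ≤ 2 * numRemoved a) := by
  decide +kernel

-- One winding component needs a total surplus of 3. The exceptional state 45 has lost 1 and 4,
-- leaving the triangle 0, 2, 3 and the isolated vertex 5. If 3 and 5 were both live in the next
-- gadget, as in 45 and 63, both pieces would pass; so the next state is neither, and supplies the
-- missing surplus of 2.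
set_option synthInstance.maxSize 1000 in
set_option synthInstance.maxHeartbeats 200000 in
theorem numEnding_of_both_pos : ∀ a < 64, ∀ b < 64, 1 ≤ numPassing a b → 1 ≤ numEnding a b →
    3 * numEnding a b + 3 ≤ 2 * numRemoved a ∨
      (a = 45 ∧ b ≠ 45 ∧ b ≠ 63 ∧ 3 * numEnding a b + 1 ≤ 2 * numRemoved a) := by
  decide +kernel

/-- This is the only property of `pieces` needed for upper bounds: with `f` the component in the
whole ring, each piece carries a single component, so counting pieces overcounts components. -/
theorem pieces_spec (l : List (Fin 6)) {α : Type*} (f : Fin 6 → α)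
    (hf : ∀ x ∈ l, ∀ y ∈ l, gadgetAdj x y = true → f x = f y) :
    (∀ x, x ∈ l ↔ ∃ p ∈ pieces l, x ∈ p) ∧
    ∀ p ∈ pieces l, ∀ x ∈ p, ∀ y ∈ p, f x = f y := by
  induction l with
  | nil => simp [pieces]
  | cons v l ih =>
    obtain ⟨ih1, ih2⟩ := ih fun x hx y hy => hf x (by simp [hx]) y (by simp [hy])
    have hcons : pieces (v :: l) = insertVertex v (pieces l) := rfl
    constructor
    · intro x
      simp only [hcons, insertVertex, List.mem_cons, ih1 x, exists_eq_or_imp, List.mem_flatten,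
        List.mem_filter]
      constructor
      · rintro (h | ⟨p, hp, hx⟩)
        · exact Or.inl (Or.inl h)
        · by_cases h : p.any (gadgetAdj v) = true
          · exact Or.inl (Or.inr ⟨p, ⟨hp, h⟩, hx⟩)
          · exact Or.inr ⟨p, ⟨hp, by simpa using h⟩, hx⟩
      · rintro ((h | ⟨p, ⟨hp, -⟩, hx⟩) | ⟨p, ⟨hp, -⟩, hx⟩)
        · exact Or.inl h
        · exact Or.inr ⟨p, hp, hx⟩
        · exact Or.inr ⟨p, hp, hx⟩
    · intro p hp
      simp only [hcons, insertVertex, List.mem_cons, List.mem_filter] at hp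
      rcases hp with rfl | ⟨hp, -⟩
      · have key : ∀ x ∈ v :: ((pieces l).filter fun p => p.any (gadgetAdj v)).flatten,
            f x = f v := by
          intro x hx
          simp only [List.mem_cons, List.mem_flatten, List.mem_filter, List.any_eq_true] at hx
          rcases hx with rfl | ⟨p, ⟨hp, y, hy, hvy⟩, hx⟩
          · rfl
          · rw [ih2 p hp x hx y hy]
            exact (hf v (by simp) y (by simp [(ih1 y).2 ⟨p, hp, hy⟩]) hvy).symm
        intro x hx y hy
        rw [key x hx, key y hy]
      · exact ih2 p hp

theorem exists_state (P : Fin 6 → Prop) : ∃ a < 64, (∀ x, x ∈ liveList a ↔ P x) := by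
  classical
  refine ⟨Nat.ofBits fun x => decide (P x), Nat.ofBits_lt_two_pow _, fun x => ?_⟩
  have h : x ∈ [(0 : Fin 6), 1, 2, 3, 4, 5] := by fin_cases x <;> simp
  simp only [liveList, List.mem_filter, h, true_and]
  rw [Nat.testBit_ofBits_lt _ _ x.2]
  simp

theorem liveList_nodup (a : ℕ) : (liveList a).Nodup :=
  List.Nodup.filter _ (by decide)

theorem card_removed (a : ℕ) (s : Finset (Fin 6)) (h : ∀ x, x ∈ liveList a ↔ x ∉ s) :
    s.card = numRemoved a := by
  have h1 : sᶜ = (liveList a).toFinset := by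
    ext x
    simp [h]
  have h2 : sᶜ.card = (liveList a).length := by
    rw [h1, List.toFinset_card_of_nodup (liveList_nodup a)]
  have h3 := s.card_add_card_compl
  simp only [Fintype.card_fin] at h3
  rw [numRemoved]
  omega

/-! ### The uniform ring and the upper bound on components. -/

/-- The ring of `m` gadgets with the same links everywhere; for even `m` it is isomorphic to
`ringGraph m`, by a reflection of the gadgets of odd index. -/
def uniformRing (m : ℕ) [NeZero m] : SimpleGraph (Fin m × Fin 6) :=
  SimpleGraph.fromRel fun x y =>
    (x.1 = y.1 ∧ (x.2, y.2) ∈ gadgetEdges) ∨ (x.1 + 1 = y.1 ∧ (x.2, y.2) ∈ links)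

theorem uniformRing_adj {m : ℕ} [NeZero m] {i k : Fin m} {x y : Fin 6} :
    (uniformRing m).Adj (i, x) (k, y) ↔
      (i = k ∧ gadgetAdj x y = true) ∨ (i + 1 = k ∧ (x, y) ∈ links) ∨
        (k + 1 = i ∧ (y, x) ∈ links) := by
  have h1 : ∀ x : Fin 6, ¬ gadgetAdj x x = true := by decide
  have h2 : ∀ x : Fin 6, (x, x) ∉ links := by decide
  simp only [uniformRing, SimpleGraph.fromRel_adj, ne_eq, Prod.mk.injEq, not_and, gadgetAdj,
    decide_eq_true_eq] at *
  constructor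
  · rintro ⟨-, (⟨rfl, h⟩ | h) | (⟨rfl, h⟩ | h)⟩ <;> simp_all
  · rintro (⟨rfl, h⟩ | h | h)
    · refine ⟨?_, by tauto⟩
      rintro - rfl
      exact h1 x h
    · refine ⟨?_, by tauto⟩
      rintro - rfl
      exact h2 x h.2
    · refine ⟨?_, by tauto⟩
      rintro - rfl
      exact h2 x h.2

theorem hasLink_iff {b : ℕ} {x : Fin 6} :
    hasLink b x = true ↔ ∃ y ∈ liveList b, (x, y) ∈ links := by
  have h : ∀ y : Fin 6, y ∈ [(0 : Fin 6), 1, 2, 3, 4, 5] := by decide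
  simp only [hasLink, liveList, List.mem_filter, h, true_and, links, Finset.mem_insert,
    Finset.mem_singleton, Prod.mk.injEq, Bool.or_eq_true, Bool.and_eq_true, beq_iff_eq]
  constructor
  · rintro ((⟨rfl, h⟩ | ⟨rfl, h⟩) | ⟨rfl, h⟩)
    · exact ⟨4, h, by simp⟩
    · exact ⟨5, h, by simp⟩
    · exact ⟨3, h, by simp⟩
  · rintro ⟨y, hy, ⟨rfl, rfl⟩ | ⟨rfl, rfl⟩ | ⟨rfl, rfl⟩⟩
    · exact Or.inl (Or.inl ⟨rfl, hy⟩)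
    · exact Or.inl (Or.inr ⟨rfl, hy⟩)
    · exact Or.inr ⟨rfl, hy⟩

/-- Distinct labels, each found in a piece satisfying `q`, are at most as many as these pieces. -/
theorem card_le_countP_pieces {α : Type*} [DecidableEq α] (l : List (Fin 6)) (f : Fin 6 → α)
    (hf : ∀ x ∈ l, ∀ y ∈ l, gadgetAdj x y = true → f x = f y) (q : List (Fin 6) → Bool)
    (s : Finset α) (hs : ∀ c ∈ s, ∃ p ∈ pieces l, q p = true ∧ ∃ x ∈ p, f x = c) :
    s.card ≤ (pieces l).countP q := by
  rw [List.countP_eq_length_filter]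
  refine le_trans ?_ (List.toFinset_card_le _)
  refine Finset.card_le_card_of_forall_subsingleton (fun c p => ∃ x ∈ p, f x = c) ?_ ?_
  · intro c hc
    obtain ⟨p, hp, hq, hx⟩ := hs c hc
    exact ⟨p, by simp [hp, hq], hx⟩
  · rintro p hp c ⟨-, x, hx, rfl⟩ d ⟨-, y, hy, rfl⟩
    simp only [List.mem_toFinset, List.mem_filter] at hp
    exact (pieces_spec l f hf).2 p hp.1 x hx y hy

theorem fin_cycle_induction {m : ℕ} [NeZero m] {P : Fin m → Prop} (h : ∀ i, P i → P (i + 1))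
    {i : Fin m} (hi : P i) (k : Fin m) : P k := by
  have key : ∀ n : ℕ, P (i + Fin.ofNat m n) := by
    intro n
    induction n with
    | zero => simpa using hi
    | succ n ih =>
      have := h _ ih
      rw [add_assoc] at this
      convert this using 2
      ext
      simp [Fin.val_add]
  have := key (k - i).val
  simpa using this

theorem sum_succ_fin {m : ℕ} [NeZero m] (g : Fin m → ℕ) : ∑ i, g (i + 1) = ∑ i, g i :=
  Equiv.sum_comp (Equiv.addRight (1 : Fin m)) g

/-- The components of the ring after the removal of `S`: at most `k` of them wind round the ring,
the others end at some gadget. -/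
theorem exists_states {m : ℕ} [NeZero m] (S : Finset (Fin m × Fin 6)) :
    ∃ (a : Fin m → ℕ) (k : ℕ), (∀ i, a i < 64) ∧ ∑ i, numRemoved (a i) = S.card ∧
      (∀ i, k ≤ numPassing (a i) (a (i + 1))) ∧
      numComponents (uniformRing m) S ≤ k + ∑ i, numEnding (a i) (a (i + 1)) := by
  classical
  choose a ha hlive using fun i : Fin m => exists_state fun x => (i, x) ∉ S
  let H := (uniformRing m).induce {v | v ∉ S}
  let f : Fin m → Fin 6 → Option H.ConnectedComponent := fun i x =>
    if h : (i, x) ∉ S then some (H.connectedComponentMk ⟨(i, x), h⟩) else none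
  have hlive' : ∀ i x c, f i x = some c → (i, x) ∉ S := by
    intro i x c h
    by_contra hS
    simp [f, hS] at h
  have hadj : ∀ i x k y, (i, x) ∉ S → (k, y) ∉ S → (uniformRing m).Adj (i, x) (k, y) →
      f i x = f k y := by
    intro i x k y hx hy hxy
    simp only [f, dif_pos hx, dif_pos hy, Option.some.injEq]
    exact SimpleGraph.ConnectedComponent.sound
      (SimpleGraph.Adj.reachable (by simpa [H] using hxy))
  have hgad : ∀ i, ∀ x ∈ liveList (a i), ∀ y ∈ liveList (a i), gadgetAdj x y = true →
      f i x = f i y := fun i x hx y hy hxy =>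
    hadj i x i y ((hlive i x).1 hx) ((hlive i y).1 hy) (uniformRing_adj.2 (Or.inl ⟨rfl, hxy⟩))
  -- A component may end at several gadgets; a union bound is enough, so no gadget has to be chosen.
  let Ends : Fin m → H.ConnectedComponent → Prop := fun i c =>
    (∃ x, f i x = some c) ∧ ∀ x, f i x = some c → ¬ hasLink (a (i + 1)) x = true
  have : Fintype H.ConnectedComponent := Fintype.ofFinite _
  let E : Fin m → Finset H.ConnectedComponent := fun i => Finset.univ.filter (Ends i)
  let T : Finset H.ConnectedComponent := Finset.univ.filter fun c => ∀ i, ¬ Ends i c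
  have hE : ∀ i, (E i).card ≤ numEnding (a i) (a (i + 1)) := by
    intro i
    rw [← Finset.card_map Function.Embedding.some, numEnding]
    refine card_le_countP_pieces _ (f i) (hgad i) _ _ ?_
    intro c hc
    simp only [Finset.mem_map, Function.Embedding.some_apply] at hc
    obtain ⟨c, hc, rfl⟩ := hc
    obtain ⟨⟨x, hx⟩, hlink⟩ := (Finset.mem_filter.1 hc).2
    obtain ⟨p, hp, hxp⟩ :=
      ((pieces_spec _ (f i) (hgad i)).1 x).1 ((hlive i x).2 (hlive' i x c hx))
    refine ⟨p, hp, ?_, x, hxp, hx⟩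
    simp only [Bool.not_eq_true', List.any_eq_false]
    intro y hy
    refine hlink y ?_
    rw [← hx]
    exact (pieces_spec _ (f i) (hgad i)).2 p hp y hy x hxp
  have hT : ∀ c ∈ T, ∀ i, ∃ x, f i x = some c ∧ hasLink (a (i + 1)) x = true := by
    intro c hc
    have hc' : ∀ i, ¬ Ends i c := (Finset.mem_filter.1 hc).2
    have hstep : ∀ i, (∃ x, f i x = some c) →
        ∃ x, f i x = some c ∧ hasLink (a (i + 1)) x = true := by
      intro i hi
      by_contra hcon
      push Not at hcon
      exact hc' i ⟨hi, hcon⟩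
    have hstart : ∃ i x, f i x = some c := by
      induction c using SimpleGraph.ConnectedComponent.ind with
      | h v => exact ⟨v.1.1, v.1.2, dif_pos (c := v.1 ∉ S) v.2⟩
    obtain ⟨i, hi⟩ := hstart
    -- A component that never ends follows a live link from each gadget it meets, hence meets all of
    -- them.
    refine fun k => hstep k (fin_cycle_induction (P := fun i => ∃ y, f i y = some c) ?_ hi k)
    intro i hi
    obtain ⟨y, hy, hl⟩ := hstep i hi
    obtain ⟨z, hz, hyz⟩ := hasLink_iff.1 hl
    refine ⟨z, ?_⟩
    rw [← hy]
    exact (hadj i y (i + 1) z (hlive' i y c hy) ((hlive _ z).1 hz)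
      (uniformRing_adj.2 (Or.inr (Or.inl ⟨rfl, hyz⟩)))).symm
  refine ⟨a, T.card, ha, ?_, ?_, ?_⟩
  · have h1 : ∀ i, numRemoved (a i) = (Finset.univ.filter fun x => (i, x) ∈ S).card := by
      intro i
      rw [card_removed]
      intro x
      simp [hlive i x]
    simp only [h1]
    rw [← Finset.card_sigma]
    refine Finset.card_bij (fun p _ => (p.1, p.2)) ?_ ?_ ?_
    · rintro ⟨i, x⟩ h
      simpa using h
    · rintro ⟨i, x⟩ - ⟨j, y⟩ - h
      simp only [Prod.mk.injEq] at h
      obtain ⟨rfl, rfl⟩ := h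
      rfl
    · rintro ⟨i, x⟩ h
      exact ⟨⟨i, x⟩, by simpa using h, rfl⟩
  · intro i
    rw [← Finset.card_map Function.Embedding.some, numPassing]
    refine card_le_countP_pieces _ (f i) (hgad i) _ _ ?_
    intro c hc
    simp only [Finset.mem_map, Function.Embedding.some_apply] at hc
    obtain ⟨c, hc, rfl⟩ := hc
    obtain ⟨x, hx, hl⟩ := hT c hc i
    obtain ⟨p, hp, hxp⟩ :=
      ((pieces_spec _ (f i) (hgad i)).1 x).1 ((hlive i x).2 (hlive' i x c hx))
    exact ⟨p, hp, List.any_eq_true.2 ⟨x, hxp, hl⟩, x, hxp, hx⟩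
  · have h1 : (Finset.univ : Finset H.ConnectedComponent) ⊆ T ∪ Finset.univ.biUnion E := by
      intro c _
      by_cases hc : ∀ i, ¬ Ends i c
      · exact Finset.mem_union_left _ (by simpa [T] using hc)
      · push Not at hc
        obtain ⟨i, hi⟩ := hc
        exact Finset.mem_union_right _
          (Finset.mem_biUnion.2 ⟨i, Finset.mem_univ _, by simpa [E] using hi⟩)
    calc numComponents (uniformRing m) S = Nat.card H.ConnectedComponent := rfl
      _ = (Finset.univ : Finset H.ConnectedComponent).card := by
        rw [Nat.card_eq_fintype_card, Finset.card_univ]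
      _ ≤ _ := Finset.card_le_card h1
      _ ≤ _ := Finset.card_union_le _ _
      _ ≤ _ := Nat.add_le_add_left (Finset.card_biUnion_le.trans (Finset.sum_le_sum fun i _ => hE i)) _

/-- The `k` winding components call for a surplus of `3k` in `2|S| - 3E`. For `k = 0` the potential
telescopes; for `k = 1` either nothing ends and there is at most one component, or one or two
gadgets supply 3; for `k = 2` every gadget supplies 4. -/
theorem numComponents_le {m : ℕ} [NeZero m] (hm : 4 ≤ m) (S : Finset (Fin m × Fin 6)) :
    numComponents (uniformRing m) S ≤ 1 ∨ 3 * numComponents (uniformRing m) S ≤ 2 * S.card := by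
  obtain ⟨a, k, ha, hS, hk, hc⟩ := exists_states S
  set E := ∑ i, numEnding (a i) (a (i + 1)) with hE
  have hk2 : k ≤ 2 := (hk 0).trans (numPassing_le_two _ (ha _) _ (ha _))
  have h3E : ∑ i, 3 * numEnding (a i) (a (i + 1)) = 3 * E := by rw [hE, Finset.mul_sum]
  have h2S : ∑ i, 2 * numRemoved (a i) = 2 * S.card := by rw [← hS, Finset.mul_sum]
  interval_cases k
  · right
    have h := Finset.sum_le_sum fun (i : Fin m) (_ : i ∈ Finset.univ) =>
      numEnding_le_potential (a i) (ha i) (a (i + 1)) (ha (i + 1))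
    rw [Finset.sum_add_distrib, Finset.sum_add_distrib,
      sum_succ_fin fun i => potential (a i)] at h
    omega
  · by_cases h0 : E = 0
    · left
      omega
    right
    have hle : ∀ i, 3 * numEnding (a i) (a (i + 1)) ≤ 2 * numRemoved (a i) := fun i =>
      (numEnding_of_numPassing_pos (a i) (ha i) _ (ha _) (hk i)).1
    obtain ⟨i, -, hi⟩ := Finset.exists_ne_zero_of_sum_ne_zero h0
    have hi1 : 1 ≤ numEnding (a i) (a (i + 1)) := Nat.one_le_iff_ne_zero.2 hi
    suffices h : 3 * E + 3 ≤ 2 * S.card by omega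
    rw [← h3E, ← h2S]
    rcases numEnding_of_both_pos (a i) (ha i) _ (ha _) (hk i) hi1 with h | ⟨-, h45, h63, h⟩
    · rw [← Finset.add_sum_erase _ _ (Finset.mem_univ i),
        ← Finset.add_sum_erase _ (fun i => 2 * numRemoved (a i)) (Finset.mem_univ i)]
      have := Finset.sum_le_sum fun (j : Fin m) (_ : j ∈ Finset.univ.erase i) => hle j
      omega
    -- Gadget `i` is in state 45 with surplus 1; gadget `i + 1`, a different one, adds 2.
    · have hne : i + 1 ∈ Finset.univ.erase i := by
        simp only [Finset.mem_erase, Finset.mem_univ, and_true, ne_eq, add_eq_left]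
        intro h
        have := congrArg Fin.val h
        rw [Fin.val_one', Fin.val_zero, Nat.mod_eq_of_lt (by omega)] at this
        omega
      have h' := ((numEnding_of_numPassing_pos _ (ha (i + 1)) _ (ha (i + 1 + 1))
        (hk (i + 1))).2.resolve_left h45).resolve_left h63
      rw [← Finset.add_sum_erase _ _ (Finset.mem_univ i), ← Finset.add_sum_erase _ _ hne,
        ← Finset.add_sum_erase _ (fun i => 2 * numRemoved (a i)) (Finset.mem_univ i),
        ← Finset.add_sum_erase _ (fun i => 2 * numRemoved (a i)) hne]
      have := Finset.sum_le_sum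
        fun (j : Fin m) (_ : j ∈ (Finset.univ.erase i).erase (i + 1)) => hle j
      omega
  · right
    have h := Finset.sum_le_sum fun (i : Fin m) (_ : i ∈ Finset.univ) =>
      numEnding_of_two_le_numPassing (a i) (ha i) (a (i + 1)) (ha (i + 1)) (hk i)
    rw [Finset.sum_add_distrib] at h
    simp only [Finset.sum_const, Finset.card_univ, Fintype.card_fin, smul_eq_mul] at h
    -- The surplus is at least `4m ≥ 16`, while 6 suffices.
    omega

theorem isTough_uniformRing {m : ℕ} [NeZero m] (hm : 4 ≤ m) :
    IsTough (uniformRing m) (3 / 2) := by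
  intro S
  rcases numComponents_le hm S with h | h
  · exact le_max_of_le_left (by exact_mod_cast h)
  · refine le_max_of_le_right ?_
    have h' : (3 * numComponents (uniformRing m) S : ℝ) ≤ 2 * S.card := by exact_mod_cast h
    linarith

/-! ### Lower bounds on components, exact toughness and minimality. -/

/-- If a labelling is constant on the edges left after the removal of `S`, then the number of
labels is a lower bound for the number of components. -/
theorem card_le_numComponents {V α : Type*} [Finite V] (G : SimpleGraph V) (S : Finset V)
    (f : V → α) (hf : ∀ u v, u ∉ S → v ∉ S → G.Adj u v → f u = f v) (R : Finset V)
    (hR : ∀ v ∈ R, v ∉ S) (hinj : Set.InjOn f R) : R.card ≤ numComponents G S := by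
  let H := G.induce {v | v ∉ S}
  let F : H.ConnectedComponent → α := SimpleGraph.ConnectedComponent.lift (fun v => f v.1) (by
    rintro v w p -
    induction p with
    | nil => rfl
    | @cons u v w h _ ih => exact (hf _ _ u.2 v.2 h).trans ih)
  have hinj' : Function.Injective fun v : R => H.connectedComponentMk ⟨v.1, hR v.1 v.2⟩ := by
    intro u v huv
    have h : f u.1 = f v.1 := congrArg F huv
    exact Subtype.ext (hinj u.2 v.2 h)
  have := Nat.card_le_card_of_injective _ hinj'
  simpa [numComponents] using this

/-- A description of the state and the labels of the six vertices of each gadget of a ring: the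
gadgets `0, …, 3`, and two gadgets repeated alternately after them. The code `12` means that the
vertex is removed; `c < 6` that it has the label of vertex `c` of the same gadget, and `6 + c` that
it has the label of vertex `c` of the previous gadget. -/
abbrev Pattern := List (List ℕ)

/-- The code of vertex `x` in the gadget number `r` of a pattern. -/
def Pattern.code (W : Pattern) (r : ℕ) (x : Fin 6) : ℕ := (W.getD r []).getD x 0

/-- The entry of a pattern that describes the gadget at distance `k` from the first one. -/
def patternIndex (k : ℕ) : ℕ := if k < 4 then k else 4 + k % 2

/-- The entry of a pattern after the entry `r`. -/
def nextIndex (r : ℕ) : ℕ := if r = 5 then 4 else r + 1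

/-- The number of labels that a pattern introduces at entry `r`. -/
def Pattern.labels (W : Pattern) (r : ℕ) : ℕ :=
  (Finset.univ.filter fun x : Fin 6 => W.code r x = x).card

/-- The number of vertices that a pattern removes at entry `r`. -/
def Pattern.removed (W : Pattern) (r : ℕ) : ℕ :=
  (Finset.univ.filter fun x : Fin 6 => W.code r x = 12).card

/-- The labels of a pattern are constant on the edges inside a gadget, except perhaps the edge
`ex` at entry `p` (if `ex` is in a gadget, that is, if `l` is false). -/
def Pattern.ValidInside (W : Pattern) (p : ℕ) (l : Bool) (ex : Fin 6 × Fin 6) : Prop :=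
  ∀ r < 6, ∀ xy ∈ gadgetEdges, W.code r xy.1 ≠ 12 → W.code r xy.2 ≠ 12 →
    ¬ (r = p ∧ l = false ∧ xy = ex) → W.code r xy.1 = W.code r xy.2

/-- The labels of a pattern are constant on the links, except perhaps the link `ex` at entry `p`
(if `l` is true), and the pattern can be closed to a ring after an odd entry. -/
def Pattern.ValidLinks (W : Pattern) (p : ℕ) (l : Bool) (ex : Fin 6 × Fin 6) : Prop :=
  (∀ r < 6, ∀ xy ∈ links, W.code r xy.1 ≠ 12 → W.code (nextIndex r) xy.2 ≠ 12 →
    ¬ (r = p ∧ l = true ∧ xy = ex) → W.code (nextIndex r) xy.2 = W.code r xy.1 + 6) ∧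
  ∀ xy ∈ links, W.code 0 xy.2 ≠ 12 → W.code 3 xy.1 = 12 ∧ W.code 5 xy.1 = 12

set_option synthInstance.maxSize 2000 in
instance (W : Pattern) (p : ℕ) (l : Bool) (ex : Fin 6 × Fin 6) :
    Decidable (W.ValidInside p l ex) := by
  unfold Pattern.ValidInside; infer_instance

set_option synthInstance.maxSize 2000 in
instance (W : Pattern) (p : ℕ) (l : Bool) (ex : Fin 6 × Fin 6) :
    Decidable (W.ValidLinks p l ex) := by
  unfold Pattern.ValidLinks; infer_instance

theorem patternIndex_lt (k : ℕ) : patternIndex k < 6 := by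
  unfold patternIndex; split <;> omega

theorem patternIndex_succ (k : ℕ) : patternIndex (k + 1) = nextIndex (patternIndex k) := by
  unfold patternIndex nextIndex; split_ifs <;> omega

theorem patternIndex_eq {k p : ℕ} (hp : p < 4) : patternIndex k = p ↔ k = p := by
  unfold patternIndex; split_ifs <;> omega

theorem sum_patternIndex (g : ℕ → ℕ) (n : ℕ) :
    ∑ k ∈ Finset.range (4 + 2 * n), g (patternIndex k) =
      g 0 + g 1 + g 2 + g 3 + n * (g 4 + g 5) := by
  induction n with
  | zero => simp [Finset.sum_range_succ, patternIndex]
  | succ n ih =>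
    have h : 4 + 2 * (n + 1) = 4 + 2 * n + 1 + 1 := by ring
    have h1 : patternIndex (4 + 2 * n) = 4 := by unfold patternIndex; split_ifs <;> omega
    have h2 : patternIndex (4 + 2 * n + 1) = 5 := by unfold patternIndex; split_ifs <;> omega
    rw [h, Finset.sum_range_succ, Finset.sum_range_succ, ih, h1, h2]
    ring

theorem sum_fin_sub {m : ℕ} [NeZero m] (s : Fin m) (g : ℕ → ℕ) :
    ∑ i : Fin m, g (i - s).val = ∑ k ∈ Finset.range m, g k := by
  rw [← Fin.sum_univ_eq_sum_range]
  exact Equiv.sum_comp (Equiv.subRight s) fun i : Fin m => g i.val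

theorem card_filter_prod {m : ℕ} (P : Fin m → Fin 6 → Prop) [∀ i x, Decidable (P i x)] :
    (Finset.univ.filter fun v : Fin m × Fin 6 => P v.1 v.2).card =
      ∑ i, (Finset.univ.filter fun x => P i x).card := by
  simp only [Finset.card_filter, Fintype.sum_prod_type]

theorem val_add_one_sub {m : ℕ} [NeZero m] (hm : 2 ≤ m) (i s : Fin m) :
    (i + 1 - s).val = (i - s).val + 1 ∨ ((i - s).val = m - 1 ∧ (i + 1 - s).val = 0) := by
  have h : i + 1 - s = (i - s) + 1 := by abel
  rw [h]
  generalize i - s = k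
  have hk := k.2
  rw [Fin.val_add, Fin.val_one', Nat.mod_eq_of_lt (show 1 < m by omega)]
  rcases Nat.lt_or_ge (k.val + 1) m with h | h
  · left
    rw [Nat.mod_eq_of_lt h]
  · right
    have : k.val + 1 = m := by omega
    exact ⟨by omega, by rw [this, Nat.mod_self]⟩

/-- A pattern laid round the ring from gadget `s` on gives a set whose removal leaves many
components. -/
theorem Pattern.exists_set {m n : ℕ} [NeZero m] (hm : m = 4 + 2 * n) (s : Fin m) (W : Pattern)
    {p : ℕ} {l : Bool} {ex : Fin 6 × Fin 6} (h1 : W.ValidInside p l ex)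
    (h2 : W.ValidLinks p l ex) (G : SimpleGraph (Fin m × Fin 6)) (hG : G ≤ uniformRing m)
    (hin : ∀ i x y, G.Adj (i, x) (i, y) → ¬ (patternIndex (i - s).val = p ∧ l = false ∧ (x, y) = ex))
    (hlink : ∀ i x y, G.Adj (i, x) (i + 1, y) →
      ¬ (patternIndex (i - s).val = p ∧ l = true ∧ (x, y) = ex)) :
    ∃ S : Finset (Fin m × Fin 6),
      S.card = W.removed 0 + W.removed 1 + W.removed 2 + W.removed 3 +
        n * (W.removed 4 + W.removed 5) ∧
      W.labels 0 + W.labels 1 + W.labels 2 + W.labels 3 + n * (W.labels 4 + W.labels 5) ≤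
        numComponents G S := by
  let e : Fin m → ℕ := fun i => patternIndex (i - s).val
  let S : Finset (Fin m × Fin 6) := Finset.univ.filter fun v => W.code (e v.1) v.2 = 12
  let R : Finset (Fin m × Fin 6) := Finset.univ.filter fun v => W.code (e v.1) v.2 = v.2.val
  have hS : ∀ v, v ∉ S ↔ W.code (e v.1) v.2 ≠ 12 := by simp [S]
  have hR : ∀ v, v ∈ R ↔ W.code (e v.1) v.2 = v.2.val := by simp [R]
  -- A label is the gadget and the vertex that introduced it. The `+ 1` keeps the natural
  -- subtraction from truncating at the first gadget when a code refers to the previous one.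
  let f : Fin m × Fin 6 → ℕ × ℕ := fun v =>
    ((v.1 - s).val + 1 - W.code (e v.1) v.2 / 6, W.code (e v.1) v.2 % 6)
  have hfin : ∀ i x y, (x, y) ∈ gadgetEdges → (i, x) ∉ S → (i, y) ∉ S → G.Adj (i, x) (i, y) →
      f (i, x) = f (i, y) := by
    intro i x y hxy hx hy hadj
    have := h1 _ (patternIndex_lt _) (x, y) hxy ((hS _).1 hx) ((hS _).1 hy) (hin i x y hadj)
    simp only at this
    simp only [f, e, this]
  have hflink : ∀ i x y, (x, y) ∈ links → (i, x) ∉ S → (i + 1, y) ∉ S →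
      G.Adj (i, x) (i + 1, y) → f (i, x) = f (i + 1, y) := by
    intro i x y hxy hx hy hadj
    have hx' := (hS _).1 hx
    have hy' := (hS _).1 hy
    simp only [e] at hx' hy'
    rcases val_add_one_sub (by omega) i s with h | ⟨hk, h⟩
    · rw [h, patternIndex_succ] at hy'
      have := h2.1 _ (patternIndex_lt _) (x, y) hxy hx' hy' (hlink i x y hadj)
      simp only at this
      simp only [f, e, h, patternIndex_succ, this]
      rw [Nat.add_div_right _ (by norm_num), Nat.add_mod_right]
      congr 1
      omega
    · rw [h] at hy'
      have h3 := h2.2 (x, y) hxy hy'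
      rw [hk] at hx'
      exfalso
      -- As `m` is even, the last gadget carries entry 3 if `n = 0` and entry 5 otherwise; no live
      -- link crosses the seam.
      have : patternIndex (m - 1) = 3 ∨ patternIndex (m - 1) = 5 := by
        unfold patternIndex; split_ifs <;> omega
      rcases this with h4 | h4 <;> rw [h4] at hx'
      · exact hx' h3.1
      · exact hx' h3.2
  refine ⟨S, ?_, ?_⟩
  · have : S.card = ∑ i : Fin m, W.removed (patternIndex (i - s).val) :=
      card_filter_prod fun i x => W.code (e i) x = 12
    rw [this, sum_fin_sub s fun k => W.removed (patternIndex k), hm, sum_patternIndex]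
  · have : R.card = ∑ i : Fin m, W.labels (patternIndex (i - s).val) :=
      card_filter_prod fun i x => W.code (e i) x = x
    rw [← sum_patternIndex, ← hm, ← sum_fin_sub s fun k => W.labels (patternIndex k), ← this]
    refine card_le_numComponents G S f ?_ R ?_ ?_
    · rintro ⟨i, x⟩ ⟨k, y⟩ hx hy hadj
      rcases uniformRing_adj.1 (hG hadj) with ⟨rfl, h⟩ | ⟨rfl, h⟩ | ⟨rfl, h⟩
      · rcases of_decide_eq_true h with h | h
        · exact hfin _ _ _ h hx hy hadj
        · exact (hfin _ _ _ h hy hx hadj.symm).symm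
      · exact hflink _ _ _ h hx hy hadj
      · exact (hflink _ _ _ h hy hx hadj.symm).symm
    · intro v hv
      rw [hS, (hR v).1 hv]
      have := v.2.2
      omega
    · intro u hu v hv huv
      have hu' := (hR u).1 hu
      have hv' := (hR v).1 hv
      have hu6 := u.2.2
      have hv6 := v.2.2
      simp only [f, hu', hv', Prod.mk.injEq, Nat.mod_eq_of_lt hu6, Nat.mod_eq_of_lt hv6,
        Nat.div_eq_of_lt hu6, Nat.div_eq_of_lt hv6] at huv
      refine Prod.ext ?_ (Fin.ext huv.2)
      have : (u.1 - s) = (v.1 - s) := Fin.ext (by omega)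
      exact sub_left_injective this

/-- A gadget with the labels of two isolated vertices; it alternates with `stateB`. -/
def stateA : List ℕ := [12, 1, 12, 12, 4, 12]

/-- A gadget with the labels of a triangle and an isolated vertex; it alternates with `stateA`. -/
def stateB : List ℕ := [0, 12, 0, 0, 12, 5]

/-- A pattern that shows that the edge `ex` at entry `p` cannot be deleted. -/
def Pattern.IsWitness (W : Pattern) (p : ℕ) (l : Bool) (ex : Fin 6 × Fin 6) : Prop :=
  p < 4 ∧ W.ValidInside p l ex ∧ W.ValidLinks p l ex ∧
  W.labels 4 + W.labels 5 = 4 ∧ W.removed 4 + W.removed 5 = 6 ∧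
  2 ≤ W.labels 0 + W.labels 1 + W.labels 2 + W.labels 3 ∧
  2 * (W.removed 0 + W.removed 1 + W.removed 2 + W.removed 3) <
    3 * (W.labels 0 + W.labels 1 + W.labels 2 + W.labels 3)

instance (W : Pattern) (p : ℕ) (l : Bool) (ex : Fin 6 × Fin 6) :
    Decidable (W.IsWitness p l ex) := by
  unfold Pattern.IsWitness; infer_instance

/-- The edge `ex` joins two differently labelled vertices at entry `p`, so its deletion is what
makes the labelling consistent. Entries 4 and 5 are always `stateA` and `stateB` in some order. -/
theorem exists_isWitness_inside : ∀ ex ∈ gadgetEdges, ∃ (W : Pattern) (p : ℕ),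
    W.IsWitness p false ex := by
  intro ex hex
  simp only [gadgetEdges, Finset.mem_insert, Finset.mem_singleton] at hex
  rcases hex with rfl | rfl | rfl | rfl | rfl | rfl | rfl | rfl | rfl
  · exact ⟨[[12, 1, 2, 12, 4, 12], [0, 12, 0, 0, 12, 8], stateA, stateB, stateA, stateB], 0,
      by decide +kernel⟩
  · exact ⟨[[12, 12, 2, 3, 12, 5], stateA, stateB, stateA, stateB, stateA], 0, by decide +kernel⟩
  · exact ⟨[stateB, [12, 1, 12, 11, 4, 12], stateB, stateA, stateB, stateA], 1,
      by decide +kernel⟩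
  · exact ⟨[[0, 12, 12, 0, 12, 5], [12, 12, 2, 12, 4, 5], [12, 12, 2, 12, 4, 12],
      [12, 1, 12, 3, 3, 12], stateB, stateA], 1, by decide +kernel⟩
  · exact ⟨[[12, 1, 12, 3, 12, 5], [0, 12, 0, 12, 12, 5], [12, 12, 2, 12, 4, 12],
      [12, 1, 12, 3, 3, 12], stateB, stateA], 0, by decide +kernel⟩
  · exact ⟨[[0, 1, 12, 12, 0, 12], stateB, stateA, stateB, stateA, stateB], 0, by decide +kernel⟩
  · exact ⟨[[0, 12, 2, 12, 12, 5], stateA, stateB, stateA, stateB, stateA], 0, by decide +kernel⟩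
  · exact ⟨[[0, 12, 12, 3, 12, 5], stateA, stateB, stateA, stateB, stateA], 0, by decide +kernel⟩
  · exact ⟨[[0, 0, 12, 12, 4, 12], stateB, stateA, stateB, stateA, stateB], 0, by decide +kernel⟩

theorem exists_isWitness_link : ∀ ex ∈ links, ∃ (W : Pattern) (p : ℕ), W.IsWitness p true ex := by
  intro ex hex
  simp only [links, Finset.mem_insert, Finset.mem_singleton] at hex
  rcases hex with rfl | rfl | rfl
  · exact ⟨[[12, 1, 1, 12, 4, 12], [0, 12, 0, 0, 0, 12], [12, 1, 12, 3, 3, 12], stateB, stateA,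
      stateB], 0, by decide +kernel⟩
  · exact ⟨[[0, 0, 0, 12, 0, 12], stateB, stateA, stateB, stateA, stateB], 0, by decide +kernel⟩
  · exact ⟨[stateB, [0, 0, 12, 0, 0, 12], stateB, stateA, stateB, stateA], 0, by decide +kernel⟩

/-- The repeated pair is balanced, `3 · 4 = 2 · 6`, so the strict excess of the first four entries
survives for every `n`. At least two labels there rule out the alternative `1` in the maximum. -/
theorem Pattern.IsWitness.not_isTough {m n : ℕ} [NeZero m] (hm : m = 4 + 2 * n) (s : Fin m)
    {W : Pattern} {p : ℕ} {l : Bool} {ex : Fin 6 × Fin 6} (h : W.IsWitness p l ex)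
    (G : SimpleGraph (Fin m × Fin 6)) (hG : G ≤ uniformRing m)
    (hin : ∀ i x y, G.Adj (i, x) (i, y) → ¬ ((i - s).val = p ∧ l = false ∧ (x, y) = ex))
    (hlink : ∀ i x y, G.Adj (i, x) (i + 1, y) →
      ¬ ((i - s).val = p ∧ l = true ∧ (x, y) = ex)) :
    ¬ IsTough G (3 / 2) := by
  obtain ⟨hp, h1, h2, h45, hr45, hl, hlt⟩ := h
  obtain ⟨S, hS, hc⟩ := W.exists_set hm s h1 h2 G hG
    (by simpa only [patternIndex_eq hp] using hin) (by simpa only [patternIndex_eq hp] using hlink)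
  rw [hr45] at hS
  rw [h45] at hc
  intro ht
  rcases le_max_iff.1 (ht S) with h | h
  · have h' : numComponents G S ≤ 1 := by exact_mod_cast h
    omega
  · have h' : (3 * numComponents G S : ℝ) ≤ 2 * S.card := by linarith
    have h'' : 3 * numComponents G S ≤ 2 * S.card := by exact_mod_cast h'
    omega

theorem not_isTough_deleteEdges {m n : ℕ} [NeZero m] (hm : m = 4 + 2 * n) :
    ∀ e ∈ (uniformRing m).edgeSet, ¬ IsTough ((uniformRing m).deleteEdges {e}) (3 / 2) := by
  have key : ∀ (i k : Fin m) (x y : Fin 6), (i = k ∧ (x, y) ∈ gadgetEdges) ∨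
      (i + 1 = k ∧ (x, y) ∈ links) →
      ¬ IsTough ((uniformRing m).deleteEdges {s((i, x), (k, y))}) (3 / 2) := by
    rintro i k x y (⟨rfl, h⟩ | ⟨rfl, h⟩)
    · obtain ⟨W, p, hW⟩ := exists_isWitness_inside _ h
      -- Starting the pattern `p` gadgets earlier puts entry `p` on gadget `i`.
      refine hW.not_isTough hm (i - Fin.ofNat m p) _ (SimpleGraph.deleteEdges_le _) ?_ (by simp)
      rintro j x' y' hadj ⟨hj, -, hxy⟩
      have hj' : j = i := by
        have : j - (i - Fin.ofNat m p) = Fin.ofNat m p := Fin.ext (by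
          rw [hj, Fin.val_ofNat, Nat.mod_eq_of_lt (by have := hW.1; omega)])
        rw [sub_eq_iff_eq_add] at this
        simpa using this
      simp only [Prod.mk.injEq] at hxy
      obtain ⟨rfl, rfl⟩ := hxy
      subst hj'
      simp [SimpleGraph.deleteEdges_adj] at hadj
    · obtain ⟨W, p, hW⟩ := exists_isWitness_link _ h
      refine hW.not_isTough hm (i - Fin.ofNat m p) _ (SimpleGraph.deleteEdges_le _) (by simp) ?_
      rintro j x' y' hadj ⟨hj, -, hxy⟩
      have hj' : j = i := by
        have : j - (i - Fin.ofNat m p) = Fin.ofNat m p := Fin.ext (by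
          rw [hj, Fin.val_ofNat, Nat.mod_eq_of_lt (by have := hW.1; omega)])
        rw [sub_eq_iff_eq_add] at this
        simpa using this
      simp only [Prod.mk.injEq] at hxy
      obtain ⟨rfl, rfl⟩ := hxy
      subst hj'
      simp [SimpleGraph.deleteEdges_adj] at hadj
  rintro ⟨⟨i, x⟩, ⟨k, y⟩⟩ he
  rcases uniformRing_adj.1 he with ⟨rfl, h⟩ | h | h
  · rcases of_decide_eq_true h with h | h
    · exact key _ _ _ _ (Or.inl ⟨rfl, h⟩)
    · have := key i i y x (Or.inl ⟨rfl, h⟩)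
      rwa [Sym2.eq_swap] at this
  · exact key _ _ _ _ (Or.inr h)
  · have := key _ _ _ _ (Or.inr h)
    rwa [Sym2.eq_swap] at this

theorem hasToughness_uniformRing {m n : ℕ} [NeZero m] (hm : m = 4 + 2 * n) :
    HasToughness (uniformRing m) (3 / 2) := by
  refine ⟨⟨by norm_num, isTough_uniformRing (by omega)⟩, ?_⟩
  rintro t ⟨ht0, ht⟩
  let W : Pattern := [stateA, stateB, stateA, stateB, stateA, stateB]
  -- No gadget has entry 6, so no edge is exempted.
  have h1 : W.ValidInside 6 false (0, 0) := by decide +kernel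
  have h2 : W.ValidLinks 6 false (0, 0) := by decide +kernel
  have hne : ∀ k, patternIndex k ≠ 6 := fun k => (patternIndex_lt k).ne
  obtain ⟨S, hS, hc⟩ := W.exists_set hm 0 h1 h2 (uniformRing m) le_rfl
    (by simp [hne]) (by simp [hne])
  have hS' : S.card = 12 + n * 6 := hS
  have hc' : 8 + n * 4 ≤ numComponents (uniformRing m) S := hc
  have hcR : (8 + n * 4 : ℝ) ≤ numComponents (uniformRing m) S := by exact_mod_cast hc'
  have hn : (0 : ℝ) ≤ n := n.cast_nonneg
  have := hcR.trans (ht S)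
  rcases le_max_iff.1 this with h | h
  · linarith
  · rw [hS', one_div, ← div_eq_inv_mul, le_div_iff₀ ht0] at h
    push_cast at h
    by_contra hlt
    push Not at hlt
    nlinarith

theorem isMinimallyTough_uniformRing {m n : ℕ} [NeZero m] (hm : m = 4 + 2 * n) :
    IsMinimallyTough (uniformRing m) (3 / 2) :=
  ⟨hasToughness_uniformRing hm, not_isTough_deleteEdges hm⟩

/-! ### Invariance under isomorphism. -/

section Transfer

variable {V W : Type*} {G : SimpleGraph V} {H : SimpleGraph W}

theorem numComponents_map (φ : G ≃g H) (S : Finset V) :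
    numComponents H (S.map φ.toEquiv.toEmbedding) = numComponents G S := by
  have h : ∀ v, φ v ∉ S.map φ.toEquiv.toEmbedding ↔ v ∉ S := by
    intro v
    simp only [Finset.mem_map_equiv, not_iff_not]
    exact iff_of_eq (congrArg (· ∈ S) (φ.toEquiv.symm_apply_apply v))
  let ψ : G.induce {v | v ∉ S} ≃g H.induce {v | v ∉ S.map φ.toEquiv.toEmbedding} :=
    { toEquiv := φ.toEquiv.subtypeEquiv fun v => (h v).symm
      map_rel_iff' := fun {a b} => φ.map_rel_iff' (a := a.1) (b := b.1) }
  exact (Nat.card_congr ψ.connectedComponentEquiv).symm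

theorem IsTough.of_iso (φ : G ≃g H) {t : ℝ} (h : IsTough G t) : IsTough H t := by
  intro S
  have := h (S.map φ.symm.toEquiv.toEmbedding)
  rwa [numComponents_map φ.symm, Finset.card_map] at this

theorem isTough_iff_of_iso (φ : G ≃g H) {t : ℝ} : IsTough G t ↔ IsTough H t :=
  ⟨IsTough.of_iso φ, IsTough.of_iso φ.symm⟩

theorem IsMinimallyTough.of_iso (φ : G ≃g H) {t : ℝ} (h : IsMinimallyTough G t) :
    IsMinimallyTough H t := by
  constructor
  · have := h.1
    unfold HasToughness at this ⊢
    simpa only [isTough_iff_of_iso φ] using this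
  · intro e he hT
    have he' : e.map φ.symm ∈ G.edgeSet := by
      induction e with
      | _ x y => exact φ.symm.map_adj_iff.2 he
    let ψ : H.deleteEdges {e} ≃g G.deleteEdges {e.map φ.symm} :=
      { toEquiv := φ.symm.toEquiv
        map_rel_iff' := by
          intro a b
          simp only [SimpleGraph.deleteEdges_adj, Set.mem_singleton_iff]
          refine and_congr φ.symm.map_adj_iff (not_congr ?_)
          rw [← (Sym2.map.injective φ.symm.injective).eq_iff]
          rfl }
    exact h.2 _ he' (hT.of_iso ψ)

theorem IsRegular.of_iso [Fintype V] [Fintype W] (φ : G ≃g H) {r : ℕ} (h : IsRegular G r) :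
    IsRegular H r := by
  classical
  intro v
  have h1 := h (φ.symm v)
  rw [← φ.symm.degree_eq v]
  convert h1

theorem IsPlanar.of_iso (φ : G ≃g H) (h : IsPlanar G) : IsPlanar H := by
  obtain ⟨p, arc, hp, harc, hvertex, hcross⟩ := h
  have hedge : ∀ e ∈ H.edgeSet, e.map φ.symm ∈ G.edgeSet := by
    intro e he
    induction e with
    | _ x y => exact φ.symm.map_adj_iff.2 he
  refine ⟨p ∘ φ.symm, fun e => arc (e.map φ.symm), hp.comp φ.symm.injective, ?_, ?_, ?_⟩
  · intro u v huv
    exact harc _ _ (φ.symm.map_adj_iff.2 huv)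
  · intro e he w hw
    have := hvertex _ (hedge e he) _ hw
    obtain ⟨x, hx, hxw⟩ := Sym2.mem_map.1 this
    rwa [← φ.symm.injective hxw]
  · intro e he e' he' hne
    have := hcross _ (hedge e he) _ (hedge e' he')
      (fun h => hne (Sym2.map.injective φ.symm.injective h))
    rintro z hz
    obtain ⟨v, rfl⟩ := this hz
    exact ⟨φ v, by simp⟩

theorem IsRegular.isKriesellCounterexample [Fintype V] (h : IsRegular G 4)
    (h' : IsMinimallyTough G (3 / 2)) : IsKriesellCounterexample G := by
  refine ⟨3 / 2, by norm_num, h', fun v => ?_⟩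
  have : ⌈(2 * (3 / 2) : ℝ)⌉ = 3 := by
    norm_num
  rw [this]
  have h4 := h v
  rw [h4]
  norm_num

end Transfer

/-! ### From the alternating ring to the uniform ring, and regularity. -/

/-- The reflection of a gadget. -/
def gadgetFlip : Fin 6 → Fin 6 := ![0, 4, 3, 2, 1, 5]

theorem gadgetFlip_gadgetFlip : ∀ x, gadgetFlip (gadgetFlip x) = x := by decide

/-- The isomorphism that reflects the gadgets of odd index. -/
def ringFlip (m : ℕ) : Fin m × Fin 6 ≃ Fin m × Fin 6 where
  toFun v := (v.1, if Even v.1.val then v.2 else gadgetFlip v.2)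
  invFun v := (v.1, if Even v.1.val then v.2 else gadgetFlip v.2)
  left_inv v := by
    by_cases h : Even v.1.val <;> simp [h, gadgetFlip_gadgetFlip]
  right_inv v := by
    by_cases h : Even v.1.val <;> simp [h, gadgetFlip_gadgetFlip]

theorem ringFlip_adj {m : ℕ} [NeZero m] (hm : Even m) (u v : Fin m × Fin 6) :
    (uniformRing m).Adj (ringFlip m u) (ringFlip m v) ↔ (ringGraph m).Adj u v := by
  have hg : ∀ x y, gadgetAdj (gadgetFlip x) (gadgetFlip y) = gadgetAdj x y := by decide
  have h1 : ∀ x y, (x, gadgetFlip y) ∈ links ↔ (x, y) ∈ evenLinks := by decide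
  have h2 : ∀ x y, (gadgetFlip x, y) ∈ links ↔ (x, y) ∈ oddLinks := by decide
  have hne1 : ∀ x, (x, x) ∉ gadgetEdges := by decide
  -- The parity of `m` matters only at the link from the last gadget to gadget 0.
  have hpar : ∀ i k : Fin m, i + 1 = k → (Even k.val ↔ ¬ Even i.val) := by
    rintro i k rfl
    rw [Fin.val_add, Fin.val_one', Nat.add_mod_mod]
    rcases Nat.lt_or_ge (i.val + 1) m with h | h
    · rw [Nat.mod_eq_of_lt h, Nat.even_add_one]
    · have h' : i.val + 1 = m := by omega
      rw [h', Nat.mod_self, ← Nat.even_add_one, h']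
      simpa using hm
  have hsucc : ∀ i k : Fin m, (i.val + 1) % m = k.val ↔ i + 1 = k := by
    intro i k
    rw [Fin.ext_iff, Fin.val_add, Fin.val_one', Nat.add_mod_mod]
  have hlink : ∀ (i k : Fin m) (x y : Fin 6), i + 1 = k →
      (((if Even i.val then x else gadgetFlip x), (if Even k.val then y else gadgetFlip y)) ∈ links ↔
        (Even i.val ∧ (x, y) ∈ evenLinks) ∨ (Odd i.val ∧ (x, y) ∈ oddLinks)) := by
    intro i k x y hik
    by_cases h : Even i.val
    · simp [h, hpar i k hik, h1]
    · simp [h, hpar i k hik, h2, Nat.not_even_iff_odd.1 h]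
  obtain ⟨i, x⟩ := u
  obtain ⟨k, y⟩ := v
  simp only [ringFlip, Equiv.coe_fn_mk, uniformRing_adj, ringGraph, SimpleGraph.fromRel_adj, hsucc]
  have hgad : i = k → (gadgetAdj (if Even i.val then x else gadgetFlip x)
      (if Even k.val then y else gadgetFlip y) = true ↔
        (x, y) ∈ gadgetEdges ∨ (y, x) ∈ gadgetEdges) := by
    rintro rfl
    rw [← decide_eq_true_iff (p := _ ∨ _)]
    by_cases h : Even i.val
    · simp only [h, if_true, gadgetAdj]
    · simp only [h, if_false, hg]
      rfl
  have hne : ((i = k ∧ ((x, y) ∈ gadgetEdges ∨ (y, x) ∈ gadgetEdges)) ∨ i + 1 = k ∨ k + 1 = i) →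
      (i, x) ≠ (k, y) := by
    rintro (⟨rfl, h⟩ | h | h) heq
    · simp only [Prod.mk.injEq, true_and] at heq
      subst heq
      exact h.elim (hne1 x) (hne1 x)
    · simp only [Prod.mk.injEq] at heq
      have := hpar i k h
      rw [heq.1] at this
      tauto
    · simp only [Prod.mk.injEq] at heq
      have := hpar k i h
      rw [heq.1] at this
      tauto
  have e1 : (i + 1 = k ∧ ((if Even i.val then x else gadgetFlip x),
      (if Even k.val then y else gadgetFlip y)) ∈ links) ↔ (i + 1 = k ∧
        ((Even i.val ∧ (x, y) ∈ evenLinks) ∨ (Odd i.val ∧ (x, y) ∈ oddLinks))) :=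
    and_congr_right fun h => hlink i k x y h
  have e2 : (k + 1 = i ∧ ((if Even k.val then y else gadgetFlip y),
      (if Even i.val then x else gadgetFlip x)) ∈ links) ↔ (k + 1 = i ∧
        ((Even k.val ∧ (y, x) ∈ evenLinks) ∨ (Odd k.val ∧ (y, x) ∈ oddLinks))) :=
    and_congr_right fun h => hlink k i y x h
  have e3 := and_congr_right hgad
  rw [e1, e2, e3]
  have hsymm : k = i ↔ i = k := eq_comm
  rw [hsymm]
  constructor
  · rintro (⟨h, h'⟩ | ⟨h, h'⟩ | ⟨h, h'⟩)
    · exact ⟨hne (Or.inl ⟨h, h'⟩), h'.elim (fun h' => Or.inl (Or.inl ⟨h, h'⟩))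
        fun h' => Or.inr (Or.inl ⟨h, h'⟩)⟩
    · exact ⟨hne (Or.inr (Or.inl h)), Or.inl (Or.inr ⟨h, h'⟩)⟩
    · exact ⟨hne (Or.inr (Or.inr h)), Or.inr (Or.inr ⟨h, h'⟩)⟩
  · rintro ⟨-, (⟨h, h'⟩ | h) | (⟨h, h'⟩ | h)⟩
    · exact Or.inl ⟨h, Or.inl h'⟩
    · exact Or.inr (Or.inl h)
    · exact Or.inl ⟨h, Or.inr h'⟩
    · exact Or.inr (Or.inr h)

/-- For even `m` the ring of the theorem is isomorphic to the uniform ring. -/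
def ringIso {m : ℕ} [NeZero m] (hm : Even m) : ringGraph m ≃g uniformRing m where
  toEquiv := ringFlip m
  map_rel_iff' := ringFlip_adj hm _ _

/-- The neighbours of a vertex of the uniform ring. -/
def ringNeighbors {m : ℕ} [NeZero m] (i : Fin m) : Fin 6 → List (Fin m × Fin 6) :=
  ![[(i, 1), (i, 2), (i, 3), (i, 4)], [(i, 0), (i, 2), (i, 5), (i + 1, 4)],
    [(i, 0), (i, 1), (i, 3), (i + 1, 5)], [(i, 0), (i, 2), (i, 4), (i - 1, 5)],
    [(i, 0), (i, 3), (i, 5), (i - 1, 1)], [(i, 1), (i, 4), (i + 1, 3), (i - 1, 2)]]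

/-- The four neighbours of a vertex have four different labels, so they are distinct for every `m`.
-/
theorem isRegular_uniformRing {m : ℕ} [NeZero m] : IsRegular (uniformRing m) 4 := by
  classical
  rintro ⟨i, x⟩
  have hnodup : (ringNeighbors i x).Nodup := by
    fin_cases x <;> simp [ringNeighbors]
  have hmem : (uniformRing m).neighborFinset (i, x) = (ringNeighbors i x).toFinset := by
    ext ⟨k, y⟩
    have hk : ∀ k : Fin m, k + 1 = i ↔ k = i - 1 := fun k => eq_sub_iff_add_eq.symm
    rw [SimpleGraph.mem_neighborFinset, uniformRing_adj, hk, eq_comm (a := i),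
      eq_comm (a := i + 1)]
    fin_cases x <;> fin_cases y <;> simp [ringNeighbors, gadgetAdj, gadgetEdges, links]
  rw [← SimpleGraph.card_neighborFinset_eq_degree, hmem, List.toFinset_card_of_nodup hnodup]
  fin_cases x <;> rfl

/-! ### A planar drawing of the ring

The gadgets are drawn in a horizontal strip, every other one upside down, with straight edges; the
strip is then wrapped round an annulus by the exponential map. -/

/-- The position of a vertex of the gadget number `r` of the strip. -/
def stripPoint (r : ℤ) (x : Fin 6) : ℤ × ℤ :=
  (10 * r + (![3, 6, 5, 1, 0, 3] : Fin 6 → ℤ) x,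
    (if Even r then 1 else -1) * (![1, -1, 3, 3, -1, -4] : Fin 6 → ℤ) x)

/-- The kinds of edges: `(x, y, b)` joins vertex `x` of a gadget to vertex `y` of the same gadget
or, if `b` is true, of the next one. -/
def edgeKinds : List (Fin 6 × Fin 6 × Bool) :=
  [(1, 2, false), (2, 3, false), (3, 4, false), (4, 5, false), (5, 1, false), (0, 1, false),
    (0, 2, false), (0, 3, false), (0, 4, false), (1, 4, true), (2, 5, true), (5, 3, true)]

/-- The orientation of a triangle. -/
def orient {R : Type*} [Ring R] (p q r : R × R) : R :=
  (q.1 - p.1) * (r.2 - p.2) - (q.2 - p.2) * (r.1 - p.1)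

/-- The points `r`, `s` lie on one side of the line `pq`, and not both on the line. -/
def OneSide {R : Type*} [Ring R] [LE R] (p q r s : R × R) : Prop :=
  ((0 ≤ orient p q r ∧ 0 ≤ orient p q s) ∨ (orient p q r ≤ 0 ∧ orient p q s ≤ 0)) ∧
    (orient p q r ≠ 0 ∨ orient p q s ≠ 0)

instance (p q r s : ℤ × ℤ) : Decidable (OneSide p q r s) := by
  unfold OneSide; infer_instance

/-- The distance between the gadgets of the two ends of an edge. -/
def shift (b : Bool) : ℤ := if b then 1 else 0

/-- Shifts 0 and 1 suffice: gadgets are 10 apart and an edge stays within 16 to the right of the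
origin of its gadget, so edges starting two or more gadgets apart are disjoint. -/
theorem edgeKinds_separated : ∀ t ∈ edgeKinds, ∀ t' ∈ edgeKinds, ∀ b : Bool,
    (shift b = 0 ∧ t = t') ∨
    OneSide (stripPoint 0 t.1) (stripPoint (shift t.2.2) t.2.1)
      (stripPoint (shift b) t'.1) (stripPoint (shift b + shift t'.2.2) t'.2.1) ∨
    OneSide (stripPoint (shift b) t'.1) (stripPoint (shift b + shift t'.2.2) t'.2.1)
      (stripPoint 0 t.1) (stripPoint (shift t.2.2) t.2.1) := by
  decide +kernel

theorem edgeKinds_avoid : ∀ t ∈ edgeKinds, ∀ b : Bool, ∀ w : Fin 6,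
    (shift b = 0 ∧ w = t.1) ∨ (shift b = shift t.2.2 ∧ w = t.2.1) ∨
    orient (stripPoint 0 t.1) (stripPoint (shift t.2.2) t.2.1) (stripPoint (shift b) w) ≠ 0 ∨
    ((stripPoint (shift b) w).1 < (stripPoint 0 t.1).1 ∧
      (stripPoint (shift b) w).1 < (stripPoint (shift t.2.2) t.2.1).1) ∨
    ((stripPoint 0 t.1).1 < (stripPoint (shift b) w).1 ∧
      (stripPoint (shift t.2.2) t.2.1).1 < (stripPoint (shift b) w).1) := by
  decide +kernel

/-- The real position of a vertex in the strip. -/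
noncomputable def realPoint (r : ℤ) (x : Fin 6) : ℝ × ℝ :=
  ((stripPoint r x).1, (stripPoint r x).2)

theorem realPoint_add (k r : ℤ) (x : Fin 6) : realPoint (k + r) x =
    (10 * (k : ℝ) + ((stripPoint r x).1 : ℝ),
      (if Even k then (1 : ℝ) else -1) * ((stripPoint r x).2 : ℝ)) := by
  unfold realPoint stripPoint
  refine Prod.ext ?_ ?_
  · simp only
    push_cast
    ring
  · by_cases hk : Even k <;> by_cases hr : Even r <;> simp [Int.even_add, hk, hr]

/-- Moving by `k` gadgets is a translation or, for odd `k`, a glide reflection. Orientations change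
at most in sign, so the integer checks near gadget 0 hold along the whole strip. -/
theorem orient_realPoint (k r₁ r₂ r₃ : ℤ) (x₁ x₂ x₃ : Fin 6) :
    orient (realPoint (k + r₁) x₁) (realPoint (k + r₂) x₂) (realPoint (k + r₃) x₃) =
      (if Even k then 1 else -1) *
        (orient (stripPoint r₁ x₁) (stripPoint r₂ x₂) (stripPoint r₃ x₃) : ℤ) := by
  simp only [realPoint_add, orient]
  push_cast
  ring

theorem oneSide_realPoint (k r₁ r₂ r₃ r₄ : ℤ) (x₁ x₂ x₃ x₄ : Fin 6)
    (h : OneSide (stripPoint r₁ x₁) (stripPoint r₂ x₂) (stripPoint r₃ x₃) (stripPoint r₄ x₄)) :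
    OneSide (realPoint (k + r₁) x₁) (realPoint (k + r₂) x₂) (realPoint (k + r₃) x₃)
      (realPoint (k + r₄) x₄) := by
  unfold OneSide at *
  simp only [orient_realPoint]
  by_cases hk : Even k
  · simpa [hk] using h
  · simpa [hk, or_comm] using h

/-- `orient p q` is affine and vanishes on the line `pq`. A convex combination of two values of the
same weak sign vanishes only if the nonzero one has weight 0. -/
theorem segment_inter_of_oneSide {p q r s z : ℝ × ℝ} (h : OneSide p q r s)
    (h1 : z ∈ segment ℝ p q) (h2 : z ∈ segment ℝ r s) : z = r ∨ z = s := by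
  obtain ⟨a, b, ha, hb, hab, rfl⟩ := h1
  obtain ⟨c, d, hc, hd, hcd, hz⟩ := h2
  have h0 : c * orient p q r + d * orient p q s = 0 := by
    have e : c * orient p q r + d * orient p q s = orient p q (c • r + d • s) := by
      simp only [orient, Prod.fst_add, Prod.snd_add, Prod.smul_fst, Prod.smul_snd, smul_eq_mul]
      linear_combination (p.1 * (q.2 - p.2) - p.2 * (q.1 - p.1)) * hcd
    rw [e, hz]
    have hb' : b = 1 - a := by linarith
    subst hb'
    simp only [orient, Prod.fst_add, Prod.snd_add, Prod.smul_fst, Prod.smul_snd, smul_eq_mul]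
    ring
  have h00 : c * orient p q r = 0 ∧ d * orient p q s = 0 := by
    rcases h.1 with ⟨h1, h2⟩ | ⟨h1, h2⟩
    · have := mul_nonneg hc h1
      have := mul_nonneg hd h2
      constructor <;> linarith
    · have := mul_nonpos_of_nonneg_of_nonpos hc h1
      have := mul_nonpos_of_nonneg_of_nonpos hd h2
      constructor <;> linarith
  rw [← hz]
  rcases h.2 with h | h
  · right
    have hc0 : c = 0 := (mul_eq_zero.1 h00.1).resolve_right h
    have hd1 : d = 1 := by linarith
    simp [hc0, hd1]
  · left
    have hd0 : d = 0 := (mul_eq_zero.1 h00.2).resolve_right h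
    have hc1 : c = 1 := by linarith
    simp [hd0, hc1]

/-- The segment that represents an edge in the strip. -/
noncomputable def stripEdge (k : ℤ) (t : Fin 6 × Fin 6 × Bool) : Set (ℝ × ℝ) :=
  segment ℝ (realPoint k t.1) (realPoint (k + shift t.2.2) t.2.1)

theorem realPoint_fst_mem (k : ℤ) (x : Fin 6) :
    10 * (k : ℝ) ≤ (realPoint k x).1 ∧ (realPoint k x).1 ≤ 10 * k + 6 := by
  fin_cases x <;> simp [realPoint, stripPoint] <;> norm_num

theorem shift_cases (b : Bool) : shift b = 0 ∨ shift b = 1 := by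
  cases b <;> simp [shift]

theorem stripEdge_fst_mem {k : ℤ} {t : Fin 6 × Fin 6 × Bool} {z : ℝ × ℝ} (hz : z ∈ stripEdge k t) :
    10 * (k : ℝ) ≤ z.1 ∧ z.1 ≤ 10 * k + 16 := by
  obtain ⟨a, b, ha, hb, hab, rfl⟩ := hz
  have h1 := realPoint_fst_mem k t.1
  have h2 := realPoint_fst_mem (k + shift t.2.2) t.2.1
  have hb' : b = 1 - a := by linarith
  subst hb'
  simp only [Prod.fst_add, Prod.smul_fst, smul_eq_mul]
  push_cast at h2
  have h3 : (0 : ℝ) ≤ shift t.2.2 ∧ (shift t.2.2 : ℝ) ≤ 1 := by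
    rcases shift_cases t.2.2 with h | h <;> simp [h]
  constructor <;> nlinarith

theorem realPoint_injective {k k' : ℤ} {x x' : Fin 6} (h : realPoint k x = realPoint k' x') :
    k = k' ∧ x = x' := by
  have h1 := realPoint_fst_mem k x
  have h2 := realPoint_fst_mem k' x'
  rw [h] at h1
  have hk : k = k' := by
    have e1 : (10 * k : ℝ) < 10 * (k' + 1) := by linarith
    have e2 : (10 * k' : ℝ) < 10 * (k + 1) := by linarith
    have e1' : 10 * k < 10 * (k' + 1) := by exact_mod_cast e1
    have e2' : 10 * k' < 10 * (k + 1) := by exact_mod_cast e2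
    omega
  subst hk
  refine ⟨rfl, ?_⟩
  have h0 : ∀ x x' : Fin 6, stripPoint 0 x = stripPoint 0 x' → x = x' := by decide
  apply h0
  rw [← add_zero k, realPoint_add, realPoint_add] at h
  simp only [Prod.mk.injEq, add_right_inj, Int.cast_inj] at h
  refine Prod.ext h.1 ?_
  have h2 := h.2
  split_ifs at h2 <;> simpa using h2

theorem stripEdge_inter {k k' : ℤ} {t t' : Fin 6 × Fin 6 × Bool} (ht : t ∈ edgeKinds)
    (ht' : t' ∈ edgeKinds) (hne : ¬ (k = k' ∧ t = t')) {z : ℝ × ℝ} (hz : z ∈ stripEdge k t)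
    (hz' : z ∈ stripEdge k' t') : ∃ j x, z = realPoint j x := by
  wlog hkk : k ≤ k' generalizing k k' t t'
  · exact this ht' ht (fun h => hne ⟨h.1.symm, h.2.symm⟩) hz' hz (by omega)
  have h1 := stripEdge_fst_mem hz
  have h2 := stripEdge_fst_mem hz'
  have hk2 : k' < k + 2 := by
    have e : (10 * k' : ℝ) < 10 * (k + 2) := by linarith
    have e' : 10 * k' < 10 * (k + 2) := by exact_mod_cast e
    omega
  obtain ⟨b, hb⟩ : ∃ b, k' = k + shift b := by
    rcases (show k' = k ∨ k' = k + 1 by omega) with h | h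
    · exact ⟨false, by simp [shift, h]⟩
    · exact ⟨true, by simp [shift, h]⟩
  subst hb
  unfold stripEdge at hz hz'
  rw [add_assoc] at hz'
  rw [show realPoint k t.1 = realPoint (k + 0) t.1 by rw [add_zero]] at hz
  rcases edgeKinds_separated t ht t' ht' b with h | h | h
  · exact absurd ⟨by omega, h.2⟩ hne
  · rcases segment_inter_of_oneSide (oneSide_realPoint k _ _ _ _ _ _ _ _ h) hz hz' with h | h <;>
      exact ⟨_, _, h⟩
  · rcases segment_inter_of_oneSide (oneSide_realPoint k _ _ _ _ _ _ _ _ h) hz' hz with h | h <;>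
      exact ⟨_, _, h⟩

theorem realPoint_mem_stripEdge {j k : ℤ} {w : Fin 6} {t : Fin 6 × Fin 6 × Bool}
    (ht : t ∈ edgeKinds) (h : realPoint j w ∈ stripEdge k t) :
    (j = k ∧ w = t.1) ∨ (j = k + shift t.2.2 ∧ w = t.2.1) := by
  have h1 := stripEdge_fst_mem h
  have h2 := realPoint_fst_mem j w
  have e1 : (10 * k : ℝ) < 10 * (j + 1) := by linarith
  have e2 : (10 * j : ℝ) < 10 * (k + 2) := by linarith
  have e1' : 10 * k < 10 * (j + 1) := by exact_mod_cast e1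
  have e2' : 10 * j < 10 * (k + 2) := by exact_mod_cast e2
  obtain ⟨b, hb⟩ : ∃ b, j = k + shift b := by
    rcases (show j = k ∨ j = k + 1 by omega) with h | h
    · exact ⟨false, by simp [shift, h]⟩
    · exact ⟨true, by simp [shift, h]⟩
  subst hb
  unfold stripEdge at h
  rw [show realPoint k t.1 = realPoint (k + 0) t.1 by rw [add_zero]] at h
  obtain ⟨c, d, hc, hd, hcd, hz⟩ := h
  have hc' : c = 1 - d := by linarith
  subst hc'
  rcases edgeKinds_avoid t ht b w with h | h | h | h | h
  · exact Or.inl ⟨by omega, h.2⟩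
  · exact Or.inr ⟨by omega, h.2⟩
  · exfalso
    have h0 : orient (realPoint (k + 0) t.1) (realPoint (k + shift t.2.2) t.2.1)
        (realPoint (k + shift b) w) = 0 := by
      rw [← hz]
      simp only [orient, Prod.fst_add, Prod.snd_add, Prod.smul_fst, Prod.smul_snd, smul_eq_mul]
      ring
    rw [orient_realPoint] at h0
    have h' : ((orient (stripPoint 0 t.1) (stripPoint (shift t.2.2) t.2.1)
      (stripPoint (shift b) w) : ℤ) : ℝ) = 0 := by
      split_ifs at h0 <;> simpa using h0
    exact h (by exact_mod_cast h')
  all_goals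
    exfalso
    have hz1 := congrArg Prod.fst hz
    simp only [realPoint_add, Prod.fst_add, Prod.smul_fst, smul_eq_mul] at hz1
    have f1 := h.1
    have f2 := h.2
    rw [← Int.cast_lt (R := ℝ)] at f1 f2
    rcases hd.lt_or_eq with hd' | hd'
    · have g1 := mul_nonneg hc (sub_pos.2 f1).le
      have g2 := mul_pos hd' (sub_pos.2 f2)
      linarith
    · rw [← hd'] at hz1
      linarith

/-- The strip is wrapped round an annulus, with `m` gadgets to a turn. -/
noncomputable def wrap (m : ℕ) (z : ℝ × ℝ) : ℝ × ℝ :=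
  ((Complex.exp ⟨z.2, 2 * Real.pi * z.1 / (10 * m)⟩).re,
    (Complex.exp ⟨z.2, 2 * Real.pi * z.1 / (10 * m)⟩).im)

theorem wrap_eq_wrap {m : ℕ} (hm : 0 < m) {z z' : ℝ × ℝ} :
    wrap m z = wrap m z' ↔ ∃ n : ℤ, z.1 = z'.1 + 10 * (m * n) ∧ z.2 = z'.2 := by
  have hm' : (m : ℝ) ≠ 0 := by positivity
  have h1 : wrap m z = wrap m z' ↔ Complex.exp ⟨z.2, 2 * Real.pi * z.1 / (10 * m)⟩ =
      Complex.exp ⟨z'.2, 2 * Real.pi * z'.1 / (10 * m)⟩ := by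
    rw [Complex.ext_iff, wrap, wrap, Prod.mk.injEq]
  rw [h1, Complex.exp_eq_exp_iff_exists_int]
  refine exists_congr fun n => ?_
  rw [Complex.ext_iff]
  simp only [Complex.add_re, Complex.add_im, Complex.mul_re, Complex.mul_im, Complex.I_re,
    Complex.I_im, Complex.intCast_re, Complex.intCast_im, Complex.ofReal_re, Complex.ofReal_im,
    Complex.re_ofNat, Complex.im_ofNat, mul_zero, mul_one, zero_mul, sub_zero, add_zero]
  rw [and_comm]
  refine and_congr ?_ Iff.rfl
  have hpi := Real.pi_ne_zero
  field_simp

theorem continuous_wrap (m : ℕ) : Continuous (wrap m) := by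
  unfold wrap
  simp only [Complex.exp_re, Complex.exp_im]
  fun_prop

/-- A full turn is an even number of gadgets, hence a pure translation, which `wrap` identifies with
the identity. -/
theorem realPoint_add_mul {m : ℕ} (hm : Even m) (k n : ℤ) (x : Fin 6) :
    realPoint (k + m * n) x = realPoint k x + (10 * ((m : ℝ) * n), (0 : ℝ)) := by
  have h : Even ((m : ℤ) * n) := ((Int.even_coe_nat m).2 hm).mul_right n
  refine Prod.ext ?_ ?_
  · simp only [realPoint, stripPoint, Prod.fst_add]
    push_cast
    ring
  · simp [realPoint, stripPoint, Int.even_add, h]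

theorem wrap_realPoint {m : ℕ} (hm : Even m) (hm0 : 0 < m) (k n : ℤ) (x : Fin 6) :
    wrap m (realPoint (k + m * n) x) = wrap m (realPoint k x) := by
  rw [wrap_eq_wrap hm0, realPoint_add_mul hm]
  exact ⟨n, by simp⟩

theorem mem_stripEdge_add_mul {m : ℕ} (hm : Even m) {k : ℤ} (n : ℤ) {t : Fin 6 × Fin 6 × Bool}
    {z : ℝ × ℝ} (hz : z ∈ stripEdge k t) :
    z + (10 * ((m : ℝ) * n), (0 : ℝ)) ∈ stripEdge (k + m * n) t := by
  unfold stripEdge at *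
  rw [add_right_comm, realPoint_add_mul hm, realPoint_add_mul hm]
  simpa [add_comm _ ((10 * ((m : ℝ) * n), 0) : ℝ × ℝ)] using
    (mem_segment_translate ℝ ((10 * ((m : ℝ) * n), 0) : ℝ × ℝ)).2 hz

theorem IsArc.symm {A : Set (ℝ × ℝ)} {a b : ℝ × ℝ} (h : IsArc A a b) : IsArc A b a := by
  obtain ⟨f, hf, hinj, h0, h1, rfl⟩ := h
  refine ⟨f ∘ unitInterval.symm, hf.comp unitInterval.continuous_symm,
    hinj.comp unitInterval.symm_bijective.injective, by simp [h1], by simp [h0], ?_⟩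
  rw [unitInterval.symm_bijective.surjective.range_comp]

theorem isArc_wrap_stripEdge {m : ℕ} (hm : 4 ≤ m) (k : ℤ) {t : Fin 6 × Fin 6 × Bool}
    (ht : t ∈ edgeKinds) : IsArc (wrap m '' stripEdge k t) (wrap m (realPoint k t.1))
      (wrap m (realPoint (k + shift t.2.2) t.2.1)) := by
  have hne : realPoint k t.1 ≠ realPoint (k + shift t.2.2) t.2.1 := by
    intro h
    have h' := realPoint_injective h
    have : ∀ t ∈ edgeKinds, t.1 ≠ t.2.1 := by decide
    exact this t ht h'.2
  have hinj : Set.InjOn (wrap m) (stripEdge k t) := by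
    intro z hz z' hz' h
    obtain ⟨n, h1, h2⟩ := (wrap_eq_wrap (by omega)).1 h
    have b1 := stripEdge_fst_mem hz
    have b2 := stripEdge_fst_mem hz'
    -- The segment is at most 16 wide, and a full turn is `10m ≥ 40`.
    have hn : n = 0 := by
      by_contra hn
      have hm' : (4 : ℝ) ≤ m := by exact_mod_cast hm
      rcases lt_or_gt_of_ne hn with hn | hn
      · have : (n : ℝ) ≤ -1 := by exact_mod_cast Int.le_sub_one_of_lt hn
        nlinarith
      · have : (1 : ℝ) ≤ n := by exact_mod_cast hn
        nlinarith
    rw [hn] at h1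
    exact Prod.ext (by simpa using h1) h2
  let g : unitInterval → ℝ × ℝ := fun τ =>
    AffineMap.lineMap (realPoint k t.1) (realPoint (k + shift t.2.2) t.2.1) (τ : ℝ)
  have hg : Set.range g = stripEdge k t := by
    rw [stripEdge, segment_eq_image_lineMap, Set.image_eq_range]
  refine ⟨wrap m ∘ g, ?_, ?_, by simp [g], by simp [g], by rw [Set.range_comp, hg]⟩
  · refine (continuous_wrap m).comp ?_
    exact (AffineMap.lineMap_continuous).comp continuous_subtype_val
  · intro τ τ' h
    have h' := hinj (hg ▸ Set.mem_range_self τ) (hg ▸ Set.mem_range_self τ') h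
    exact Subtype.ext (AffineMap.lineMap_injective ℝ hne h')

/-- The edge of a given kind that starts in the gadget `i`. -/
def kindEdge {m : ℕ} [NeZero m] (i : Fin m) (t : Fin 6 × Fin 6 × Bool) :
    Sym2 (Fin m × Fin 6) :=
  s((i, t.1), (if t.2.2 then i + 1 else i, t.2.1))

theorem fin_eq_shift {m : ℕ} [NeZero m] {i j : Fin m} {n : ℤ} {b : Bool}
    (h : (i.val : ℤ) + m * n = j.val + shift b) : i = if b then j + 1 else j := by
  have hi : (i.val : ℤ) = ((j.val : ℤ) + shift b) % m := by
    rw [← h, Int.add_mul_emod_self_left, Int.emod_eq_of_lt (by omega) (by exact_mod_cast i.2)]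
  apply Fin.ext
  cases b
  · simp only [shift, Bool.false_eq_true, if_false, add_zero] at hi ⊢
    rw [Int.emod_eq_of_lt (by omega) (by exact_mod_cast j.2)] at hi
    exact_mod_cast hi
  · simp only [shift, if_true] at hi ⊢
    rw [Fin.val_add, Fin.val_one', Nat.add_mod_mod]
    exact_mod_cast hi

theorem shift_val {m : ℕ} [NeZero m] (i : Fin m) (b : Bool) :
    ∃ n : ℤ, ((if b then i + 1 else i : Fin m).val : ℤ) + m * n = i.val + shift b := by
  cases b
  · exact ⟨0, by simp [shift]⟩
  · refine ⟨((i.val : ℤ) + 1) / m, ?_⟩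
    simp only [shift, if_true]
    rw [Fin.val_add, Fin.val_one', Nat.add_mod_mod]
    push_cast
    exact Int.emod_add_mul_ediv _ _

/-- The labels of the two ends determine the kind and its direction: no label pair occurs twice,
even reversed. -/
theorem kindEdge_injective {m : ℕ} [NeZero m] {i i' : Fin m}
    {t t' : Fin 6 × Fin 6 × Bool} (ht : t ∈ edgeKinds) (ht' : t' ∈ edgeKinds)
    (h : kindEdge i t = kindEdge i' t') : i = i' ∧ t = t' := by
  have hkind : ∀ t ∈ edgeKinds, ∀ t' ∈ edgeKinds, t.1 = t'.1 → t.2.1 = t'.2.1 → t = t' := by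
    decide +kernel
  have hrev : ∀ t ∈ edgeKinds, ∀ t' ∈ edgeKinds, t.1 = t'.2.1 → t.2.1 = t'.1 → False := by
    decide +kernel
  rcases Sym2.eq_iff.1 h with ⟨ha, hb⟩ | ⟨ha, hb⟩
  · simp only [Prod.mk.injEq] at ha hb
    exact ⟨ha.1, hkind t ht t' ht' ha.2 hb.2⟩
  · simp only [Prod.mk.injEq] at ha hb
    exact (hrev t ht t' ht' ha.2 hb.2).elim

theorem exists_kindEdge {m : ℕ} [NeZero m] {u v : Fin m × Fin 6} (h : (uniformRing m).Adj u v) :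
    ∃ i, ∃ t ∈ edgeKinds, (u = (i, t.1) ∧ v = (if t.2.2 then i + 1 else i, t.2.1)) ∨
      (v = (i, t.1) ∧ u = (if t.2.2 then i + 1 else i, t.2.1)) := by
  have hg : ∀ xy ∈ gadgetEdges, (xy.1, xy.2, false) ∈ edgeKinds := by decide
  have hl : ∀ xy ∈ links, (xy.1, xy.2, true) ∈ edgeKinds := by decide
  obtain ⟨i, x⟩ := u
  obtain ⟨k, y⟩ := v
  rcases uniformRing_adj.1 h with ⟨rfl, hxy⟩ | ⟨rfl, hxy⟩ | ⟨rfl, hxy⟩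
  · rcases of_decide_eq_true hxy with hxy | hxy
    · exact ⟨i, _, hg _ hxy, by simp⟩
    · exact ⟨i, _, hg _ hxy, by simp⟩
  · exact ⟨i, _, hl _ hxy, by simp⟩
  · exact ⟨k, _, hl _ hxy, by simp⟩

theorem isPlanar_uniformRing {m : ℕ} [NeZero m] (hm : Even m) (hm4 : 4 ≤ m) :
    IsPlanar (uniformRing m) := by
  have hm0 : 0 < m := by omega
  let p : Fin m × Fin 6 → ℝ × ℝ := fun v => wrap m (realPoint v.1.val v.2)
  have hp : ∀ (i : Fin m) (b : Bool) (x : Fin 6),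
      wrap m (realPoint (i.val + shift b) x) = p (if b then i + 1 else i, x) := by
    intro i b x
    obtain ⟨n, hn⟩ := shift_val i b
    rw [← hn, wrap_realPoint hm hm0]
  have hpmem : ∀ j x, wrap m (realPoint j x) ∈ Set.range p := by
    intro j x
    have hj0 : 0 ≤ j % m := Int.emod_nonneg _ (by omega)
    have hjm : j % m < m := Int.emod_lt_of_pos _ (by omega)
    refine ⟨(⟨(j % m).toNat, by omega⟩, x), ?_⟩
    conv_rhs => rw [← Int.emod_add_mul_ediv j m, wrap_realPoint hm hm0]
    simp [p, Int.toNat_of_nonneg hj0]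
  -- The union over all presentations of `e` avoids choosing an orientation; `kindEdge_injective`
  -- reduces it to one segment.
  let arc : Sym2 (Fin m × Fin 6) → Set (ℝ × ℝ) := fun e =>
    {z | ∃ i, ∃ t ∈ edgeKinds, kindEdge i t = e ∧ z ∈ wrap m '' stripEdge (i.val : ℤ) t}
  have harc : ∀ (i : Fin m), ∀ t ∈ edgeKinds,
      arc (kindEdge i t) = wrap m '' stripEdge (i.val : ℤ) t := by
    intro i t ht
    ext z
    constructor
    · rintro ⟨i', t', ht', h, hz⟩
      obtain ⟨rfl, rfl⟩ := kindEdge_injective ht' ht h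
      exact hz
    · intro hz
      exact ⟨i, t, ht, rfl, hz⟩
  have hlift : ∀ z z' : ℝ × ℝ, wrap m z = wrap m z' → ∃ n : ℤ,
      z = z' + (10 * ((m : ℝ) * n), (0 : ℝ)) := by
    intro z z' h
    obtain ⟨n, h1, h2⟩ := (wrap_eq_wrap hm0).1 h
    exact ⟨n, Prod.ext h1 (by simpa using h2)⟩
  refine ⟨p, arc, ?_, ?_, ?_, ?_⟩
  · rintro ⟨i, x⟩ ⟨j, y⟩ h
    obtain ⟨n, hn⟩ := hlift _ _ h
    rw [← realPoint_add_mul hm] at hn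
    obtain ⟨h1, h2⟩ := realPoint_injective hn
    have := fin_eq_shift (i := j) (j := i) (b := false) (by rw [← h1]; simp [shift])
    simp only [Bool.false_eq_true, if_false] at this
    exact Prod.ext this.symm h2
  · intro u v huv
    obtain ⟨i, t, ht, h⟩ := exists_kindEdge huv
    have key : IsArc (arc (kindEdge i t)) (p (i, t.1)) (p (if t.2.2 then i + 1 else i, t.2.1)) := by
      rw [harc i t ht, ← hp]
      exact isArc_wrap_stripEdge hm4 _ ht
    rcases h with ⟨rfl, rfl⟩ | ⟨rfl, rfl⟩
    · exact key
    · rw [Sym2.eq_swap]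
      exact key.symm
  · rintro e - ⟨j, w⟩ ⟨i, t, ht, rfl, z, hz, hzw⟩
    obtain ⟨n, hn⟩ := hlift _ _ hzw
    rw [← realPoint_add_mul hm] at hn
    rw [hn] at hz
    rcases realPoint_mem_stripEdge ht hz with ⟨h1, h2⟩ | ⟨h1, h2⟩ <;> simp only at h1 h2
    · have := fin_eq_shift (i := j) (j := i) (b := false) (n := n) (by rw [h1]; simp [shift])
      simp only [Bool.false_eq_true, if_false] at this
      rw [this, h2]
      exact Sym2.mem_mk_left _ _
    · rw [fin_eq_shift h1, h2]
      exact Sym2.mem_mk_right _ _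
  · rintro e - e' - hne z ⟨⟨i, t, ht, rfl, z₁, hz₁, rfl⟩, ⟨i', t', ht', rfl, z₂, hz₂, h⟩⟩
    obtain ⟨n, hn⟩ := hlift _ _ h
    -- The two preimages differ by `n` full turns; translating the first segment makes them meet in
    -- the strip itself.
    have hz₁' := mem_stripEdge_add_mul hm n hz₁
    rw [← hn] at hz₁'
    obtain ⟨j, x, hjx⟩ := stripEdge_inter ht' ht (by
      rintro ⟨h1, rfl⟩
      have := fin_eq_shift (i := i) (j := i') (b := false) (n := n) (by rw [← h1]; simp [shift])
      simp only [Bool.false_eq_true, if_false] at this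
      exact hne (by rw [this])) hz₂ hz₁'
    rw [← h, hjx]
    exact hpmem j x

/-! ### Assembly. -/

theorem ringGraph_properties {m : ℕ} (hm : Even m) (hm4 : 4 ≤ m) :
    IsPlanar (ringGraph m) ∧ IsRegular (ringGraph m) 4 ∧
      IsMinimallyTough (ringGraph m) (3 / 2) := by
  have : NeZero m := ⟨by omega⟩
  obtain ⟨n, hn⟩ : ∃ n, m = 4 + 2 * n := by
    obtain ⟨k, hk⟩ := hm
    exact ⟨k - 2, by omega⟩
  have φ := (ringIso hm).symm
  exact ⟨(isPlanar_uniformRing hm hm4).of_iso φ, isRegular_uniformRing.of_iso φ,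
    (isMinimallyTough_uniformRing hn).of_iso φ⟩

end ToughRing

theorem mainTheorem3 :
    (∀ m : ℕ, Even m → 4 ≤ m →
      Fintype.card (Fin m × Fin 6) = 6 * m ∧
      ToughRing.IsPlanar (ToughRing.ringGraph m) ∧
      ToughRing.IsRegular (ToughRing.ringGraph m) 4 ∧
      ToughRing.HasToughness (ToughRing.ringGraph m) (3 / 2) ∧
      ToughRing.IsMinimallyTough (ToughRing.ringGraph m) (3 / 2) ∧
      ToughRing.IsKriesellCounterexample (ToughRing.ringGraph m)) ∧
    {n : ℕ | ∃ G : SimpleGraph (Fin n),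
      ToughRing.IsPlanar G ∧
      ToughRing.IsRegular G 4 ∧
      ToughRing.IsMinimallyTough G (3 / 2) ∧
      ToughRing.IsKriesellCounterexample G}.Infinite := by
  constructor
  · intro m hm hm4
    obtain ⟨h1, h2, h3⟩ := ToughRing.ringGraph_properties hm hm4
    exact ⟨by simp [mul_comm], h1, h2, h3.1, h3, h2.isKriesellCounterexample h3⟩
  · refine Set.infinite_of_injective_forall_mem (f := fun k : ℕ => (4 + 2 * k) * 6) ?_ ?_
    · intro a b h
      simp only at h
      omega
    · intro k
      obtain ⟨h1, h2, h3⟩ := ToughRing.ringGraph_properties (m := 4 + 2 * k)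
        ⟨2 + k, by ring⟩ (by omega)
      have φ := SimpleGraph.Iso.map (finProdFinEquiv (m := 4 + 2 * k) (n := 6))
        (ToughRing.ringGraph (4 + 2 * k))
      exact ⟨_, h1.of_iso φ, h2.of_iso φ, h3.of_iso φ,
        (h2.of_iso φ).isKriesellCounterexample (h3.of_iso φ)⟩
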